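/- **Quantum protocols.** A quantum protocol for a pair of inputs $x,y\in\{0,1\}^n$ acts on finitely many qubits, each of which is initially in the possession of Alice or of Bob. Alice holds $n$ qubits initialized to $x$, Bob holds $n$ qubits initialized to $y$, and all other qubits start in the state $|0\rangle$. In each round one of the players applies a unitary transformation to the qubits in his possession and then sends one of his qubits to the other player; the unitaries and the qubits sent are fixed in advance. At the end one player may apply a further unitary to his qubits and then measures one of them in the computational basis; the result is the output. The communication $c$ is the number of qubits sent. The protocol computes $f$ with error $\epsilon$ if on every input $(x,y)$ the output equals $f(x,y)$ with probability at least $1-\epsilon$. **Lemma 3.3.** There is a universal constant $K$ such that the following holds for all integers $n,c\ge 0$, all Boolean functions $f:\{0,1\}^n\times\{0,1\}^n\to\{0,1\}$ and all real $d\ge 1$. If there is a quantum protocol for $f$ with communication $c$ and error $1/3$, then there are a real $\alpha\in[0,1]$ and a family of $N\le 2^{Kdc}$ (not necessarily distinct) rectangles $R_i=A_i\times B_i$ with $A_i,B_i\subseteq\{0,1\}^n$, and weights $w_i\in\{-\alpha,\alpha\}$, $1\le i\le N$, such that for all $x,y\in\{0,1\}^n$ $$\sum_{i=1}^N w_i R_i[x,y]\in\begin{cases}[1-2^{-d},\,1]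 & \text{if } f(x,y)=1,\\ [0,\,2^{-d}] & \text{if } f(x,y)=0,\end{cases}$$ where $R_i[x,y]=1$ if $(x,y)\in R_i$ and $R_i[x,y]=0$ otherwise. -/

import Mathlib

/-- The two players of a communication protocol. -/
inductive Player where
  | alice : Player
  | bob : Player
  deriving DecidableEq

/-- The opponent of a player. -/
def Player.other : Player → Player
  | .alice => .bob
  | .bob => .alice

/-- The qubits in the possession of player `P`, out of `m` qubits distributed according to `own`. -/
abbrev Held {m : ℕ} (own : Fin m → Player) (P : Player) : Type := {q : Fin m // own q = P}

/-- A pure state of `m` qubits, given by its amplitudes in the computational basis. -/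
abbrev QState (m : ℕ) : Type := (Fin m → Bool) → ℂ

/-- Replace the bits of the basis string `s` at the qubits held by `P` by the bits `t`. -/
def overwrite {m : ℕ} (own : Fin m → Player) (P : Player)
    (s : Fin m → Bool) (t : Held own P → Bool) : Fin m → Bool :=
  fun q => if h : own q = P then t ⟨q, h⟩ else s q

/-- The operator `U ⊗ 1`, where `U` acts on the qubits held by `P` and the identity acts on the
qubits of the other player. -/
def applyLocal {m : ℕ} (own : Fin m → Player) (P : Player)
    (U : Matrix (Held own P → Bool) (Held own P → Bool) ℂ) (ψ : QState m) : QState m :=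
  fun s => ∑ t : Held own P → Bool, U (fun q => s q) t * ψ (overwrite own P s t)

/-- `Rounds own c` is the type of the sequences of actions, fixed in advance, of two players who
hold `m` qubits according to `own` and still exchange exactly `c` qubits.

* `round P U q _ rest`: player `P` applies the unitary `U` to the qubits in his possession and then
  sends his qubit `q` to the other player. This changes the possession of `q`, not the global state.
* `measure P U q _`: player `P` measures his qubit `q` in the computational basis, and the result is
  the output. Just before he may apply a unitary `U` to his qubits (`U = 1` is allowed). -/
inductive Rounds {m : ℕ} : (Fin m → Player) → ℕ → Type where
  | measure {own : Fin m → Player} (P : Player)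
      (U : Matrix.unitaryGroup (Held own P → Bool) ℂ) (q : Fin m) (hq : own q = P) :
      Rounds own 0
  | round {own : Fin m → Player} {c : ℕ} (P : Player)
      (U : Matrix.unitaryGroup (Held own P → Bool) ℂ) (q : Fin m) (hq : own q = P)
      (rest : Rounds (Function.update own q P.other) c) :
      Rounds own (c + 1)

/-- The probability that the output is `b` when the actions are carried out on the state `ψ`. -/
noncomputable def Rounds.outputProb {m : ℕ} :
    {own : Fin m → Player} → {c : ℕ} → Rounds own c → QState m → Bool → ℝ
  | own, _, .measure P U q _, ψ, b =>
      ∑ s : Fin m → Bool, if s q = b then ‖applyLocal own P (U : Matrix _ _ ℂ) ψ s‖ ^ 2 else 0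
  | own, _, .round P U _ _ rest, ψ, b => rest.outputProb (applyLocal own P (U : Matrix _ _ ℂ) ψ) b

/-- A quantum protocol, without prior entanglement, for a pair of `n`-bit inputs, in which exactly
`c` qubits are exchanged. There are finitely many qubits, each of them initially in the possession
of one player; `n` qubits of Alice and `n` qubits of Bob are reserved for their inputs. -/
structure QuantumProtocol (n c : ℕ) where
  /-- The number of qubits. -/
  m : ℕ
  /-- The initial possession of the qubits. -/
  own : Fin m → Player
  /-- The qubits that are initialized to Alice's input. -/
  aliceIn : Fin n ↪ Fin m
  /-- The qubits that are initialized to Bob's input. -/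
  bobIn : Fin n ↪ Fin m
  alice_owns : ∀ i, own (aliceIn i) = Player.alice
  bob_owns : ∀ i, own (bobIn i) = Player.bob
  /-- The actions of the players. -/
  rounds : Rounds own c

namespace QuantumProtocol

variable {n c : ℕ}

/-- The basis string in which the protocol starts: the input qubits hold `x` and `y`, all other
qubits are `0`. -/
def initBits (P : QuantumProtocol n c) (x y : Fin n → Bool) : Fin P.m → Bool :=
  fun q => decide ((∃ i, P.aliceIn i = q ∧ x i = true) ∨ (∃ i, P.bobIn i = q ∧ y i = true))

/-- The initial state, a computational basis state. -/
noncomputable def initState (P : QuantumProtocol n c) (x y : Fin n → Bool) : QState P.m :=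
  Pi.single (P.initBits x y) 1

/-- The probability that the protocol outputs `b` on the input `(x, y)`. -/
noncomputable def outputProb (P : QuantumProtocol n c) (x y : Fin n → Bool) (b : Bool) : ℝ :=
  P.rounds.outputProb (P.initState x y) b

/-- On every input the protocol gives the correct answer with probability at least `1 - ε`. -/
def ComputesWithError (P : QuantumProtocol n c)
    (f : (Fin n → Bool) × (Fin n → Bool) → Bool) (ε : ℝ) : Prop :=
  ∀ x y, 1 - ε ≤ P.outputProb x y (f (x, y))

end QuantumProtocol

/-- A rectangle is a product set `A × B` of inputs. -/
def IsRectangle {X Y : Type} (R : Set (X × Y)) : Prop :=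
  ∃ (A : Set X) (B : Set Y), R = A ×ˢ B

/-! A state built with `c` qubits of communication is a superposition of at most `2 ^ c` products of
an Alice part and a Bob part, since each qubit sent only splits a product according to its bit.
Acceptance probabilities are quadratic in the state, so they form a matrix of rank at most `4 ^ c`
whose factors are bounded by 1 (`Rounds.exists_outputProb_eq_sum`).

Rounding the factors to a grid of width `2 ^ (-O(c))` turns this matrix, up to a small constant
error, into a multiple of an integer matrix. The latter is a signed sum of `2 ^ O(c)` rectangles,
because a bounded integer function of one input is a signed sum of its threshold sets
(`exists_isSignedRectangleSum_near`).

The error is reduced to `2 ^ (-d)` by the majority polynomial of degree `O(d)`. Rectangles are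
closed under intersection, so the degree only enters the exponent of their number, and
homogenization keeps all weights equal up to sign (`IsSignedRectangleSum.exists_majority`). The case
`c = 0` is separate, because only one rectangle is allowed there. -/

/-! ### Signed sums of rectangles. -/

/-- `g` is a sum of at most `N` indicator functions of rectangles with signs. -/
def IsSignedRectangleSum {X Y : Type} (g : X × Y → ℤ) (N : ℕ) : Prop :=
  ∃ (ι : Type) (_ : Fintype ι) (R : ι → Set (X × Y)) (ε : ι → ℤ),
    Fintype.card ι ≤ N ∧ (∀ i, IsRectangle (R i)) ∧ (∀ i, ε i = 1 ∨ ε i = -1) ∧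
      ∀ p, g p = ∑ i, ε i * (R i).indicator (fun _ => (1 : ℤ)) p

theorem IsRectangle.inter {X Y : Type} {R S : Set (X × Y)} (hR : IsRectangle R)
    (hS : IsRectangle S) : IsRectangle (R ∩ S) := by
  obtain ⟨A, B, rfl⟩ := hR
  obtain ⟨A', B', rfl⟩ := hS
  exact ⟨A ∩ A', B ∩ B', Set.prod_inter_prod⟩

namespace IsSignedRectangleSum

variable {X Y : Type} {g g' : X × Y → ℤ} {N N' : ℕ}

theorem mono (h : IsSignedRectangleSum g N) (hN : N ≤ N') : IsSignedRectangleSum g N' := by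
  obtain ⟨ι, _, R, ε, hc, h⟩ := h
  exact ⟨ι, _, R, ε, hc.trans hN, h⟩

theorem zero : IsSignedRectangleSum (fun _ : X × Y => 0) 0 :=
  ⟨Empty, inferInstance, Empty.elim, Empty.elim, by simp, fun i => i.elim, fun i => i.elim,
    by simp⟩

theorem indicator {R : Set (X × Y)} (hR : IsRectangle R) :
    IsSignedRectangleSum (R.indicator fun _ => 1) 1 :=
  ⟨Unit, inferInstance, fun _ => R, fun _ => 1, by simp, fun _ => hR, by simp, by simp⟩

theorem one : IsSignedRectangleSum (fun _ : X × Y => 1) 1 := by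
  simpa using indicator (R := (Set.univ : Set (X × Y))) ⟨Set.univ, Set.univ, by simp⟩

theorem neg (h : IsSignedRectangleSum g N) : IsSignedRectangleSum (fun p => -g p) N := by
  obtain ⟨ι, _, R, ε, hc, hR, hε, hg⟩ := h
  refine ⟨ι, _, R, fun i => -ε i, hc, hR, fun i => ?_, fun p => by simp [hg]⟩
  rcases hε i with h | h <;> simp [h]

theorem add (h : IsSignedRectangleSum g N) (h' : IsSignedRectangleSum g' N') :
    IsSignedRectangleSum (fun p => g p + g' p) (N + N') := by
  obtain ⟨ι, _, R, ε, hc, hR, hε, hg⟩ := h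
  obtain ⟨ι', _, R', ε', hc', hR', hε', hg'⟩ := h'
  refine ⟨ι ⊕ ι', inferInstance, Sum.elim R R', Sum.elim ε ε', by simp; omega, ?_, ?_, ?_⟩
  · rintro (i | i) <;> simp [hR, hR']
  · rintro (i | i) <;> simp [hε, hε']
  · intro p
    simp [hg, hg']

/-- A product of two rectangle indicators is the indicator of the intersection, again a rectangle.
-/
theorem mul (h : IsSignedRectangleSum g N) (h' : IsSignedRectangleSum g' N') :
    IsSignedRectangleSum (fun p => g p * g' p) (N * N') := by
  obtain ⟨ι, _, R, ε, hc, hR, hε, hg⟩ := h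
  obtain ⟨ι', _, R', ε', hc', hR', hε', hg'⟩ := h'
  refine ⟨ι × ι', inferInstance, fun i => R i.1 ∩ R' i.2, fun i => ε i.1 * ε' i.2,
    by simpa using Nat.mul_le_mul hc hc', fun i => (hR _).inter (hR' _), ?_, ?_⟩
  · rintro ⟨i, j⟩
    rcases hε i with h | h <;> rcases hε' j with h' | h' <;> simp [h, h']
  · intro p
    simp only [hg, hg', Finset.sum_mul_sum, Fintype.sum_prod_type]
    refine Finset.sum_congr rfl fun i _ => Finset.sum_congr rfl fun j _ => ?_
    by_cases h1 : p ∈ R i <;> by_cases h2 : p ∈ R' j <;> simp [h1, h2]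

theorem pow (h : IsSignedRectangleSum g N) (k : ℕ) :
    IsSignedRectangleSum (fun p => g p ^ k) (N ^ k) := by
  induction k with
  | zero => simpa using one
  | succ k ih => simpa only [pow_succ] using ih.mul h

theorem sum {ι : Type*} (s : Finset ι) {g : ι → X × Y → ℤ} {N : ι → ℕ}
    (h : ∀ i ∈ s, IsSignedRectangleSum (g i) (N i)) :
    IsSignedRectangleSum (fun p => ∑ i ∈ s, g i p) (∑ i ∈ s, N i) := by
  classical
  induction s using Finset.induction_on with
  | empty => simpa using zero
  | insert a s ha ih =>
    simp only [Finset.sum_insert ha]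
    exact (h a (by simp)).add (ih fun i hi => h i (by simp [hi]))

/-- Coefficients must be signs, so a constant costs that many copies of the full rectangle. -/
theorem natCast (k : ℕ) : IsSignedRectangleSum (fun _ : X × Y => (k : ℤ)) k := by
  simpa using sum (X := X) (Y := Y) (Finset.range k) (g := fun _ _ => 1) (N := fun _ => 1)
    fun _ _ => one

/-- Layer-cake formula: the positive part of `z` counts the `j < z`, the negative part the `j < -z`.
-/
theorem eq_sum_thresholds {z : ℤ} {L : ℕ} (h : |z| ≤ L) :
    z = ∑ j ∈ Finset.range L,
      ((if (j : ℤ) < z then 1 else 0) + -(if (j : ℤ) < -z then 1 else 0)) := by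
  have key : ∀ (L : ℕ) (z : ℤ), z ≤ L →
      ∑ j ∈ Finset.range L, (if (j : ℤ) < z then (1 : ℤ) else 0) = max z 0 := by
    intro L
    induction L with
    | zero => intro z hz; simp at hz; simp [hz]
    | succ L ih =>
      intro z hz
      rw [Finset.sum_range_succ]
      rcases le_or_gt z L with h | h
      · rw [ih z h, if_neg (by omega), add_zero]
      · rw [Finset.sum_congr rfl (g := fun _ => (1 : ℤ)), if_pos h]
        · simp; push_cast at hz; omega
        · intro j hj
          rw [if_pos]
          have := Finset.mem_range.1 hj
          omega
  rw [Finset.sum_add_distrib, Finset.sum_neg_distrib, key L z ((le_abs_self z).trans h),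
    key L (-z) ((neg_le_abs z).trans h)]
  omega

/-- Each threshold set of `a`, times all of `Y`, is a rectangle; there are `L` of either sign. -/
theorem of_fst {a : X → ℤ} {L : ℕ} (h : ∀ x, |a x| ≤ L) :
    IsSignedRectangleSum (fun p : X × Y => a p.1) (2 * L) := by
  have hr : ∀ S : Set X, IsSignedRectangleSum
      (fun p : X × Y => S.indicator (fun _ => (1 : ℤ)) p.1) 1 := fun S => by
    convert indicator (R := S ×ˢ (Set.univ : Set Y)) ⟨S, Set.univ, rfl⟩ using 2 with p
    by_cases hp : p.1 ∈ S <;> simp [Set.mem_prod, hp]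
  have := sum (Finset.range L) fun j _ =>
    (hr {x | (j : ℤ) < a x}).add (hr {x | (j : ℤ) < -a x}).neg
  convert this using 1
  · ext p
    rw [eq_sum_thresholds (h p.1)]
    simp [Set.indicator]
  · simp [mul_comm]

theorem swap (h : IsSignedRectangleSum g N) :
    IsSignedRectangleSum (fun p : Y × X => g p.swap) N := by
  obtain ⟨ι, _, R, ε, hc, hR, hε, hg⟩ := h
  refine ⟨ι, _, fun i => Prod.swap ⁻¹' R i, ε, hc, fun i => ?_, hε, fun p => ?_⟩
  · obtain ⟨A, B, h⟩ := hR i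
    exact ⟨B, A, by ext ⟨y, x⟩; simp [h, and_comm]⟩
  · exact hg _

theorem of_snd {b : Y → ℤ} {L : ℕ} (h : ∀ y, |b y| ≤ L) :
    IsSignedRectangleSum (fun p : X × Y => b p.2) (2 * L) :=
  (of_fst (Y := X) h).swap

end IsSignedRectangleSum

/-! ### Amplification by majority, and rounding. -/

/-- The probability that the majority of `2 * h + 1` independent coins of bias `t` is heads. -/
noncomputable def majority (h : ℕ) (t : ℝ) : ℝ :=
  ∑ k ∈ Finset.Ico (h + 1) (2 * h + 2),
    ((2 * h + 1).choose k : ℝ) * t ^ k * (1 - t) ^ (2 * h + 1 - k)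

theorem majority_nonneg (h : ℕ) {t : ℝ} (h0 : 0 ≤ t) (h1 : t ≤ 1) : 0 ≤ majority h t :=
  Finset.sum_nonneg fun k _ => by
    have := sub_nonneg.2 h1
    positivity

/-- Exchanging heads and tails exchanges the two outcomes; an odd number of coins has no tie. -/
theorem majority_add_majority (h : ℕ) (t : ℝ) : majority h t + majority h (1 - t) = 1 := by
  have h1 : (t + (1 - t)) ^ (2 * h + 1) = 1 := by simp
  rw [add_pow, Finset.range_eq_Ico,
    ← Finset.sum_Ico_consecutive _ (Nat.zero_le (h + 1)) (by omega : h + 1 ≤ 2 * h + 1 + 1)] at h1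
  refine Eq.trans ?_ h1
  rw [add_comm]
  refine congrArg₂ _ ?_ (Finset.sum_congr rfl fun k _ => by ring)
  refine Finset.sum_bij' (fun k _ => 2 * h + 1 - k) (fun k _ => 2 * h + 1 - k) ?_ ?_ ?_ ?_ ?_
  · intro k hk; simp at hk ⊢; omega
  · intro k hk; simp at hk ⊢; omega
  · intro k hk; simp at hk ⊢; omega
  · intro k hk; simp at hk ⊢; omega
  · intro k hk
    simp only [Finset.mem_Ico] at hk
    rw [Nat.choose_symm (by omega), sub_sub_cancel, Nat.sub_sub_self (by omega)]
    ring

/-- Since `t ≤ 1 - t`, surplus factors `t` may be replaced by `1 - t`, which bounds each monomial by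
`(t * (1 - t)) ^ h`. All binomial coefficients together give `2 * 4 ^ h`. -/
theorem majority_le_of_le_half (h : ℕ) {t : ℝ} (h0 : 0 ≤ t) (h1 : t ≤ 1 / 2) :
    majority h t ≤ 2 * (4 * (t * (1 - t))) ^ h := by
  have hterm : ∀ k ∈ Finset.Ico (h + 1) (2 * h + 2),
      ((2 * h + 1).choose k : ℝ) * t ^ k * (1 - t) ^ (2 * h + 1 - k) ≤
        ((2 * h + 1).choose k : ℝ) * (t * (1 - t)) ^ h := by
    intro k hk
    simp only [Finset.mem_Ico] at hk
    obtain ⟨j, rfl⟩ := Nat.exists_eq_add_of_le hk.1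
    obtain ⟨i, rfl⟩ := Nat.exists_eq_add_of_le (by omega : j ≤ h)
    have e : 2 * (j + i) + 1 - (j + i + 1 + j) = i := by omega
    rw [e, mul_assoc]
    refine mul_le_mul_of_nonneg_left ?_ (by positivity)
    have ht : 0 ≤ 1 - t := by linarith
    calc t ^ (j + i + 1 + j) * (1 - t) ^ i = (t ^ (j + i) * (1 - t) ^ i) * (t ^ j * t) := by ring
      _ ≤ (t ^ (j + i) * (1 - t) ^ i) * ((1 - t) ^ j * 1) := by
          gcongr <;> linarith
      _ = (t * (1 - t)) ^ (j + i) := by rw [mul_pow]; ring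
  calc majority h t ≤ ∑ k ∈ Finset.Ico (h + 1) (2 * h + 2),
        ((2 * h + 1).choose k : ℝ) * (t * (1 - t)) ^ h := Finset.sum_le_sum hterm
    _ ≤ ∑ k ∈ Finset.range (2 * h + 1 + 1), ((2 * h + 1).choose k : ℝ) * (t * (1 - t)) ^ h := by
        refine Finset.sum_le_sum_of_subset_of_nonneg (fun k hk => ?_) fun k _ _ => ?_
        · simp at hk ⊢; omega
        · have : 0 ≤ t * (1 - t) := mul_nonneg h0 (by linarith)
          positivity
    _ = 2 * (4 * (t * (1 - t))) ^ h := by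
        rw [← Finset.sum_mul, ← Nat.cast_sum, Nat.sum_range_choose, mul_pow 4]
        push_cast
        rw [pow_succ, pow_mul]
        norm_num
        ring

/-- Amplification: the homogenized majority polynomial of an integer matrix. -/
theorem IsSignedRectangleSum.exists_majority {X Y : Type} {M : X × Y → ℤ} {N B : ℕ} (hB : 0 < B)
    (hM : IsSignedRectangleSum M N) (h : ℕ) :
    ∃ G : X × Y → ℤ, IsSignedRectangleSum G ((2 * N + B) ^ (2 * h + 1)) ∧
      ∀ p, (1 / (B : ℝ) ^ (2 * h + 1)) * G p = majority h (M p / B) := by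
  refine ⟨fun p => ∑ k ∈ Finset.Ico (h + 1) (2 * h + 2),
    ((2 * h + 1).choose k : ℤ) * M p ^ k * (B + -M p) ^ (2 * h + 1 - k), ?_, fun p => ?_⟩
  · refine (sum (Finset.Ico (h + 1) (2 * h + 2)) fun k _ =>
      ((natCast ((2 * h + 1).choose k)).mul (hM.pow k)).mul
        (((natCast B).add hM.neg).pow (2 * h + 1 - k))).mono ?_
    -- The counts of the terms are those of the binomial expansion of `(N + (B + N)) ^ (2 * h + 1)`.
    rw [show 2 * N + B = N + (B + N) by ring, add_pow]
    refine (Finset.sum_le_sum_of_subset (t := Finset.range (2 * h + 1 + 1)) fun k hk => ?_).trans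
      (Finset.sum_le_sum fun k _ => le_of_eq (by simp; ring))
    simp at hk ⊢
    omega
  · have hB' : (B : ℝ) ≠ 0 := by positivity
    push_cast
    rw [majority, Finset.mul_sum]
    refine Finset.sum_congr rfl fun k hk => ?_
    simp only [Finset.mem_Ico] at hk
    have e : (B : ℝ) ^ (2 * h + 1) = (B : ℝ) ^ k * (B : ℝ) ^ (2 * h + 1 - k) := by
      rw [← pow_add]; congr 1; omega
    rw [e, one_sub_div hB', div_pow, div_pow, ← sub_eq_add_neg]
    field_simp

/-- Rounding of a matrix of low rank to a multiple of an integer matrix. -/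
theorem exists_isSignedRectangleSum_near {X Y : Type} {κ : Type} [Fintype κ] (u : κ → X → ℝ)
    (v : κ → Y → ℝ) (hu : ∀ k x, |u k x| ≤ 1) (hv : ∀ k y, |v k y| ≤ 1) (L : ℕ) :
    ∃ M : X × Y → ℤ, IsSignedRectangleSum M (4 * Fintype.card κ * L ^ 2) ∧
      ∀ p, |(M p : ℝ) - L ^ 2 * ∑ k, u k p.1 * v k p.2| ≤ 2 * Fintype.card κ * L := by
  have hfl : ∀ r : ℝ, |r| ≤ 1 → |⌊L * r⌋| ≤ (L : ℤ) := by
    intro r hr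
    rw [abs_le] at hr ⊢
    have hL : (0 : ℝ) ≤ L := by positivity
    constructor
    · rw [Int.le_floor]; push_cast; nlinarith
    · rw [← Int.cast_le (R := ℝ)]
      refine (Int.floor_le _).trans ?_
      push_cast; nlinarith
  -- Both factors are rounded down to multiples of `1 / L`; each `k` then costs `2 * L` times `2 *
  -- L` rectangles.
  refine ⟨fun p => ∑ k, ⌊L * u k p.1⌋ * ⌊L * v k p.2⌋, ?_, fun p => ?_⟩
  · refine (IsSignedRectangleSum.sum Finset.univ fun k _ =>
      (IsSignedRectangleSum.of_fst (fun x => hfl _ (hu k x))).mul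
        (IsSignedRectangleSum.of_snd fun y => hfl _ (hv k y))).mono (le_of_eq ?_)
    simp
    ring
  · push_cast
    rw [Finset.mul_sum, ← Finset.sum_sub_distrib]
    refine (Finset.abs_sum_le_sum_abs _ _).trans ?_
    rw [show 2 * (Fintype.card κ : ℝ) * L = ∑ _k : κ, 2 * (L : ℝ) by simp; ring]
    refine Finset.sum_le_sum fun k _ => ?_
    set a := u k p.1
    set b := v k p.2
    have ha : |(⌊L * a⌋ : ℝ) - L * a| ≤ 1 := by
      rw [abs_le]; constructor <;> linarith [Int.floor_le (L * a), Int.lt_floor_add_one (L * a)]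
    have hb : |(⌊L * b⌋ : ℝ) - L * b| ≤ 1 := by
      rw [abs_le]; constructor <;> linarith [Int.floor_le (L * b), Int.lt_floor_add_one (L * b)]
    have ha' : |(⌊L * a⌋ : ℝ)| ≤ L := by exact_mod_cast hfl a (hu k _)
    have hb' : |L * b| ≤ L := by
      rw [abs_mul, Nat.abs_cast]
      exact mul_le_of_le_one_right (by positivity) (hv k _)
    calc |(⌊L * a⌋ : ℝ) * ⌊L * b⌋ - L ^ 2 * (a * b)|
        = |(⌊L * a⌋ : ℝ) * (⌊L * b⌋ - L * b) + (⌊L * a⌋ - L * a) * (L * b)| := by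
          congr 1; ring
      _ ≤ |(⌊L * a⌋ : ℝ)| * |⌊L * b⌋ - L * b| + |⌊L * a⌋ - L * a| * |L * b| := by
          rw [← abs_mul, ← abs_mul]; exact abs_add_le _ _
      _ ≤ L * 1 + 1 * L := by gcongr
      _ = 2 * L := by ring

/-! ### States of a protocol as superpositions of product states. -/

theorem Player.other_ne (P : Player) : P.other ≠ P := by cases P <;> decide

theorem Player.eq_other_of_ne {P Q : Player} (h : Q ≠ P) : Q = P.other := by
  cases P <;> cases Q <;> simp_all [Player.other]

/-- The part of a basis string that is stored in the qubits of player `P`. -/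
def restrictBits {m : ℕ} (own : Fin m → Player) (P : Player) (s : Fin m → Bool) :
    Held own P → Bool :=
  fun q => s q

/-- A basis string consists of the parts held by the two players. -/
def splitBits {m : ℕ} (own : Fin m → Player) (P : Player) :
    (Fin m → Bool) ≃ (Held own P → Bool) × (Held own P.other → Bool) where
  toFun s := (restrictBits own P s, restrictBits own P.other s)
  invFun t q := if h : own q = P then t.1 ⟨q, h⟩ else t.2 ⟨q, Player.eq_other_of_ne h⟩
  left_inv s := by ext q; simp [restrictBits]
  right_inv t := by
    ext ⟨q, hq⟩
    · simp [restrictBits, hq]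
    · simp [restrictBits, hq, Player.other_ne]

theorem restrictBits_overwrite {m : ℕ} (own : Fin m → Player) (P : Player) (s : Fin m → Bool)
    (t : Held own P → Bool) : restrictBits own P (overwrite own P s t) = t := by
  ext ⟨q, hq⟩
  simp [restrictBits, overwrite, hq]

theorem restrictBits_other_overwrite {m : ℕ} (own : Fin m → Player) (P : Player)
    (s : Fin m → Bool) (t : Held own P → Bool) :
    restrictBits own P.other (overwrite own P s t) = restrictBits own P.other s := by
  ext ⟨q, hq⟩
  simp [restrictBits, overwrite, hq, Player.other_ne]

theorem sum_norm_sq_mulVec {α : Type*} [Fintype α] [DecidableEq α]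
    (U : Matrix.unitaryGroup α ℂ) (v : α → ℂ) :
    ∑ i, ‖(U : Matrix α α ℂ).mulVec v i‖ ^ 2 = ∑ i, ‖v i‖ ^ 2 := by
  have key : ∀ w : α → ℂ, ((∑ i, ‖w i‖ ^ 2 : ℝ) : ℂ) = star w ⬝ᵥ w := by
    intro w
    simp [dotProduct, Complex.conj_mul']
  have h : ((∑ i, ‖(U : Matrix α α ℂ).mulVec v i‖ ^ 2 : ℝ) : ℂ) = (∑ i, ‖v i‖ ^ 2 : ℝ) := by
    rw [key, key, Matrix.star_mulVec, Matrix.dotProduct_mulVec, Matrix.vecMul_vecMul,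
      ← Matrix.star_eq_conjTranspose, Matrix.UnitaryGroup.star_mul_self, Matrix.vecMul_one]
  exact_mod_cast h

/-- With the other player's bits fixed, the operator is `U` acting on a slice of `ψ`. -/
theorem sum_norm_sq_applyLocal {m : ℕ} (own : Fin m → Player) (P : Player)
    (U : Matrix.unitaryGroup (Held own P → Bool) ℂ) (ψ : QState m) :
    ∑ s, ‖applyLocal own P (U : Matrix _ _ ℂ) ψ s‖ ^ 2 = ∑ s, ‖ψ s‖ ^ 2 := by
  rw [← Equiv.sum_comp (splitBits own P).symm, ← Equiv.sum_comp (splitBits own P).symm,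
    Fintype.sum_prod_type_right, Fintype.sum_prod_type_right]
  refine Finset.sum_congr rfl fun t' _ => ?_
  refine Eq.trans ?_ (sum_norm_sq_mulVec U fun t => ψ ((splitBits own P).symm (t, t')))
  refine Finset.sum_congr rfl fun t _ => ?_
  congr 2
  simp only [applyLocal, Matrix.mulVec, dotProduct]
  refine Finset.sum_congr rfl fun r _ => ?_
  refine congrArg₂ _ (congrArg (fun a => U.1 a r) ?_) (congrArg ψ ?_)
  · ext ⟨q, hq⟩
    simp [splitBits, hq]
  · ext q
    by_cases h : own q = P <;> simp [splitBits, overwrite, h]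

theorem Rounds.outputProb_true_add_false {m : ℕ} {own : Fin m → Player} {c : ℕ}
    (r : Rounds own c) (ψ : QState m) :
    r.outputProb ψ true + r.outputProb ψ false = ∑ s, ‖ψ s‖ ^ 2 := by
  induction r generalizing ψ with
  | measure P U q hq =>
    rw [← sum_norm_sq_applyLocal _ P U]
    simp only [Rounds.outputProb]
    rw [← Finset.sum_add_distrib]
    refine Finset.sum_congr rfl fun s _ => ?_
    cases s q <;> simp
  | round P U q hq rest ih => rw [← sum_norm_sq_applyLocal _ P U, ← ih]; rfl

theorem Rounds.outputProb_nonneg {m : ℕ} {own : Fin m → Player} {c : ℕ}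
    (r : Rounds own c) (ψ : QState m) (b : Bool) : 0 ≤ r.outputProb ψ b := by
  induction r generalizing ψ with
  | measure P U q hq =>
    exact Finset.sum_nonneg fun s _ => by split <;> positivity
  | round P U q hq rest ih => exact ih _

/-- A superposition, indexed by `ι`, of (unnormalized) product states, whose factors are functions
of the inputs of the respective players. -/
def productSum {m : ℕ} {own : Fin m → Player} {ι X : Type} [Fintype ι]
    (F : ∀ P, ι → X → (Held own P → Bool) → ℂ) (z : Player → X) : QState m :=
  fun s => ∑ i, ∏ P ∈ {Player.alice, Player.bob}, F P i (z P) (restrictBits own P s)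

theorem Player.prod_eq {M : Type*} [CommMonoid M] (g : Player → M) (P : Player) :
    ∏ Q ∈ {Player.alice, Player.bob}, g Q = g P * g P.other := by
  rw [Finset.prod_pair (by decide)]
  cases P
  · rfl
  · exact mul_comm _ _

/-- The effect of a local unitary on the factors of a superposition of product states. -/
def updateFactor {m : ℕ} {own : Fin m → Player} {ι X : Type}
    (F : ∀ P, ι → X → (Held own P → Bool) → ℂ) (P : Player)
    (U : Matrix (Held own P → Bool) (Held own P → Bool) ℂ) :
    ∀ P, ι → X → (Held own P → Bool) → ℂ :=
  Function.update F P fun i x => U.mulVec (F P i x)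

theorem applyLocal_productSum {m : ℕ} {own : Fin m → Player} {ι X : Type} [Fintype ι]
    (F : ∀ P, ι → X → (Held own P → Bool) → ℂ) (z : Player → X) (P : Player)
    (U : Matrix (Held own P → Bool) (Held own P → Bool) ℂ) :
    applyLocal own P U (productSum F z) = productSum (updateFactor F P U) z := by
  ext s
  simp only [applyLocal, productSum, Player.prod_eq _ P, restrictBits_overwrite,
    restrictBits_other_overwrite, updateFactor, Function.update_self,
    Function.update_of_ne P.other_ne, Matrix.mulVec, dotProduct, Finset.mul_sum, Finset.sum_mul]
  rw [Finset.sum_comm]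
  refine Finset.sum_congr rfl fun i _ => Finset.sum_congr rfl fun t _ => ?_
  rw [← mul_assoc]
  rfl

theorem sum_norm_sq_updateFactor {m : ℕ} {own : Fin m → Player} {ι X : Type}
    (F : ∀ P, ι → X → (Held own P → Bool) → ℂ) (P : Player)
    (U : Matrix.unitaryGroup (Held own P → Bool) ℂ) (Q : Player) (i : ι) (x : X) :
    ∑ t, ‖updateFactor F P (U : Matrix _ _ ℂ) Q i x t‖ ^ 2 = ∑ t, ‖F Q i x t‖ ^ 2 := by
  by_cases h : Q = P
  · subst h
    simp only [updateFactor, Function.update_self]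
    exact sum_norm_sq_mulVec U _
  · simp [updateFactor, Function.update_of_ne h]

theorem Held.own_eq_of_update {m : ℕ} {own : Fin m → Player} {P : Player} {q r : Fin m}
    {Q : Player} (hr : own r = Q) (h : ¬ r = q) : Function.update own q P r = Q := by
  rw [Function.update_of_ne h, hr]

/-- The bits of player `Q` before the qubit `q`, whose value is `b`, changes hands. -/
def insertBit {m : ℕ} {own : Fin m → Player} {P : Player} (q : Fin m) (b : Bool) (Q : Player)
    (t : Held (Function.update own q P) Q → Bool) : Held own Q → Bool :=
  fun r => if h : (r : Fin m) = q then b else t ⟨r, Held.own_eq_of_update r.2 h⟩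

/-- The effect of sending a qubit on the factors of a superposition of product states. -/
noncomputable def sendFactor {m : ℕ} {own : Fin m → Player} {ι X : Type}
    (F : ∀ P, ι → X → (Held own P → Bool) → ℂ) (q : Fin m) (P : Player) :
    ∀ Q, ι × Bool → X → (Held (Function.update own q P) Q → Bool) → ℂ := by
  classical
  exact fun Q i x t =>
    if ∀ h : Function.update own q P q = Q, t ⟨q, h⟩ = i.2 then F Q i.1 x (insertBit q i.2 Q t)
    else 0

/-- Every product is split by the value `b` of the qubit `q`. A player who has lost `q` uses the
recorded `b`, and the new holder's factor vanishes unless his bit is `b`. Only `b = s q` survives,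
so the state is unchanged while the number of terms doubles. -/
theorem productSum_sendFactor {m : ℕ} {own : Fin m → Player} {ι X : Type} [Fintype ι]
    (F : ∀ P, ι → X → (Held own P → Bool) → ℂ) (z : Player → X) (q : Fin m) (P : Player) :
    productSum (sendFactor F q P) z = productSum F z := by
  ext s
  simp only [productSum, Fintype.sum_prod_type]
  refine Finset.sum_congr rfl fun i _ => ?_
  rw [Finset.sum_eq_single (s q)]
  · refine Finset.prod_congr rfl fun Q _ => ?_
    have e : insertBit q (s q) Q (restrictBits (Function.update own q P) Q s) =
        restrictBits own Q s := by
      ext ⟨r, hr⟩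
      by_cases h : r = q <;> simp [insertBit, restrictBits, h]
    simp [sendFactor, e]
    simp [restrictBits]
  · intro b _ hb
    rw [Player.prod_eq _ P, sendFactor, if_neg, zero_mul]
    intro h
    exact hb (h (Function.update_self ..)).symm
  · simp

theorem insertBit_injOn {m : ℕ} {own : Fin m → Player} {P : Player} (q : Fin m) (b : Bool)
    (Q : Player) :
    Set.InjOn (insertBit (own := own) (P := P) q b Q)
      {t | ∀ h : Function.update own q P q = Q, t ⟨q, h⟩ = b} := by
  intro t ht t' ht' h
  ext ⟨r, hr⟩
  by_cases hrq : r = q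
  · subst hrq
    rw [ht hr, ht' hr]
  · have hr' : own r = Q := by rwa [Function.update_of_ne hrq] at hr
    simpa [insertBit, hrq] using congrFun h ⟨r, hr'⟩

/-- The nonzero entries of the new factor are entries of the old one, none used twice by
`insertBit_injOn`. -/
theorem sum_norm_sq_sendFactor_le {m : ℕ} {own : Fin m → Player} {ι X : Type}
    (F : ∀ P, ι → X → (Held own P → Bool) → ℂ) (q : Fin m) (P Q : Player) (i : ι × Bool) (x : X) :
    ∑ t, ‖sendFactor F q P Q i x t‖ ^ 2 ≤ ∑ t, ‖F Q i.1 x t‖ ^ 2 := by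
  classical
  have : ∀ t, ‖sendFactor F q P Q i x t‖ ^ 2 =
      if ∀ h : Function.update own q P q = Q, t ⟨q, h⟩ = i.2 then
        ‖F Q i.1 x (insertBit q i.2 Q t)‖ ^ 2 else 0 := by
    intro t
    simp only [sendFactor]
    split <;> simp
  simp only [this]
  rw [← Finset.sum_filter,
    ← Finset.sum_image (f := fun t => ‖F Q i.1 x t‖ ^ 2) (g := insertBit q i.2 Q)]
  · exact Finset.sum_le_sum_of_subset_of_nonneg (Finset.subset_univ _) fun _ _ _ => by positivity
  · intro t ht t' ht' h
    simp only [Finset.coe_filter, Finset.mem_univ, true_and] at ht ht'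
    exact insertBit_injOn q i.2 Q ht ht' h

theorem norm_sum_mul_star_le_one {α : Type*} [Fintype α] (v w : α → ℂ)
    (hv : ∑ i, ‖v i‖ ^ 2 ≤ 1) (hw : ∑ i, ‖w i‖ ^ 2 ≤ 1) (p : α → Prop) [DecidablePred p] :
    ‖∑ i, if p i then v i * star (w i) else 0‖ ≤ 1 := by
  calc ‖∑ i, if p i then v i * star (w i) else 0‖
      ≤ ∑ i, ‖if p i then v i * star (w i) else 0‖ := norm_sum_le _ _
    _ ≤ ∑ i, (‖v i‖ ^ 2 + ‖w i‖ ^ 2) / 2 := by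
        refine Finset.sum_le_sum fun i _ => ?_
        split
        · rw [norm_mul, norm_star]
          nlinarith [sq_nonneg (‖v i‖ - ‖w i‖)]
        · simp; positivity
    _ ≤ 1 := by
        rw [← Finset.sum_div, Finset.sum_add_distrib]
        linarith

/-- The distribution of the measurement of a superposition of product states. -/
theorem sum_norm_sq_productSum {m : ℕ} {own : Fin m → Player} {ι X : Type} [Fintype ι]
    (F : ∀ P, ι → X → (Held own P → Bool) → ℂ) (z : Player → X) (P : Player) (q : Fin m)
    (hq : own q = P) (b : Bool) :
    ((∑ s : Fin m → Bool, if s q = b then ‖productSum F z s‖ ^ 2 else 0 : ℝ) : ℂ) =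
      ∑ i, ∑ j, (∑ t, if t ⟨q, hq⟩ = b then F P i (z P) t * star (F P j (z P) t) else 0) *
        ∑ t, F P.other i (z P.other) t * star (F P.other j (z P.other) t) := by
  rw [← Equiv.sum_comp (splitBits own P).symm, Complex.ofReal_sum]
  have h1 : ∀ t t', productSum F z ((splitBits own P).symm (t, t')) =
      ∑ i, F P i (z P) t * F P.other i (z P.other) t' := by
    intro t t'
    have h := (splitBits own P).apply_symm_apply (t, t')
    simp only [productSum, Player.prod_eq _ P]
    rw [show restrictBits own P ((splitBits own P).symm (t, t')) = t from congrArg Prod.fst h,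
      show restrictBits own P.other ((splitBits own P).symm (t, t')) = t' from congrArg Prod.snd h]
  have h2 : ∀ t t', (splitBits own P).symm (t, t') q = t ⟨q, hq⟩ := by
    intro t t'
    simp [splitBits, hq]
  have h3 : ∀ p : (Held own P → Bool) × (Held own P.other → Bool),
      ((if (splitBits own P).symm p q = b then ‖productSum F z ((splitBits own P).symm p)‖ ^ 2
        else 0 : ℝ) : ℂ) =
      ∑ i, ∑ j, (if p.1 ⟨q, hq⟩ = b then F P i (z P) p.1 * star (F P j (z P) p.1) else 0) *
        (F P.other i (z P.other) p.2 * star (F P.other j (z P.other) p.2)) := by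
    rintro ⟨t, t'⟩
    rw [h1, h2]
    dsimp only
    split
    · rw [Complex.ofReal_pow, ← Complex.mul_conj', map_sum, Finset.sum_mul_sum]
      refine Finset.sum_congr rfl fun i _ => Finset.sum_congr rfl fun j _ => ?_
      simp only [map_mul, Complex.star_def]
      ring
    · simp
  simp only [h3]
  rw [Finset.sum_comm]
  refine Finset.sum_congr rfl fun i _ => ?_
  rw [Finset.sum_comm]
  refine Finset.sum_congr rfl fun j _ => ?_
  rw [Finset.sum_mul_sum, Fintype.sum_prod_type]

/-- The output probabilities of a protocol with `c` qubits of communication form a matrix of rank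
at most `4 ^ c`, with a bounded factorization. -/
theorem Rounds.exists_outputProb_eq_sum {m : ℕ} {own : Fin m → Player} {c : ℕ}
    (r : Rounds own c) (b : Bool) {ι X : Type} [Fintype ι]
    (F : ∀ P, ι → X → (Held own P → Bool) → ℂ) (hF : ∀ P i x, ∑ t, ‖F P i x t‖ ^ 2 ≤ 1) :
    ∃ (κ : Type) (_ : Fintype κ) (u : Player → κ → X → ℂ),
      Fintype.card κ = Fintype.card ι ^ 2 * 4 ^ c ∧ (∀ P k x, ‖u P k x‖ ≤ 1) ∧
      ∀ z, (r.outputProb (productSum F z) b : ℂ) =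
        ∑ k, u .alice k (z .alice) * u .bob k (z .bob) := by
  induction r generalizing ι with
  | @measure own P U q hq =>
    set F' := updateFactor F P (U : Matrix _ _ ℂ) with hF'
    have hF1 : ∀ Q i x, ∑ t, ‖F' Q i x t‖ ^ 2 ≤ 1 := fun Q i x =>
      (sum_norm_sq_updateFactor F P U Q i x).trans_le (hF Q i x)
    clear_value F'
    -- Expanding the squared norm pairs the terms `i` and `j`: the measuring player contributes an
    -- inner product restricted to outcome `b`, the other a full one. The test `True` lets the same
    -- bound serve both.
    let w : Player → ι × ι → X → ℂ := fun Q k x => if Q = P then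
        ∑ t, if t ⟨q, hq⟩ = b then F' P k.1 x t * star (F' P k.2 x t) else 0
      else ∑ t, if True then F' P.other k.1 x t * star (F' P.other k.2 x t) else 0
    refine ⟨ι × ι, inferInstance, w, ?_, ?_, ?_⟩
    · simp [sq]
    · intro Q k x
      dsimp only [w]
      split
      · exact norm_sum_mul_star_le_one _ _ (hF1 _ _ _) (hF1 _ _ _) _
      · exact norm_sum_mul_star_le_one _ _ (hF1 _ _ _) (hF1 _ _ _) _
    · intro z
      rw [Rounds.outputProb, applyLocal_productSum, ← hF', sum_norm_sq_productSum F' z P q hq,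
        Fintype.sum_prod_type]
      refine Finset.sum_congr rfl fun i _ => Finset.sum_congr rfl fun j _ => ?_
      have e := Player.prod_eq (fun Q => w Q (i, j) (z Q)) P
      rw [Finset.prod_pair (by decide)] at e
      rw [e]
      simp only [w, if_pos, if_neg P.other_ne]
  | round P U q hq rest ih =>
    have hF' : ∀ Q i x,
        ∑ t, ‖sendFactor (updateFactor F P (U : Matrix _ _ ℂ)) q P.other Q i x t‖ ^ 2 ≤ 1 := by
      intro Q i x
      refine (sum_norm_sq_sendFactor_le (updateFactor F P U.1) q P.other Q i x).trans ?_
      rw [sum_norm_sq_updateFactor F P U Q i.1 x]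
      exact hF Q i.1 x
    obtain ⟨κ, hfin, u, hκ, hu, h⟩ := ih _ hF'
    refine ⟨κ, hfin, u, ?_, hu, fun z => ?_⟩
    -- One round doubles the index type, hence the factor 4 in its square.
    · rw [hκ]
      simp
      ring
    · rw [← h z, productSum_sendFactor, ← applyLocal_productSum]
      rfl

/-- Without communication, the output depends only on the input of one player. -/
theorem Rounds.exists_outputProb_eq_of_zero {m : ℕ} {own : Fin m → Player}
    (r : Rounds own 0) (b : Bool) {X : Type}
    (F : ∀ P, Unit → X → (Held own P → Bool) → ℂ) (hF : ∀ P i x, ∑ t, ‖F P i x t‖ ^ 2 = 1) :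
    ∃ (P : Player) (u : X → ℂ), ∀ z, (r.outputProb (productSum F z) b : ℂ) = u (z P) := by
  cases r with
  | measure P U q hq =>
    refine ⟨P, fun x => ∑ t, if t ⟨q, hq⟩ = b then updateFactor F P (U : Matrix _ _ ℂ) P () x t *
      star (updateFactor F P (U : Matrix _ _ ℂ) P () x t) else 0, fun z => ?_⟩
    rw [Rounds.outputProb, applyLocal_productSum, sum_norm_sq_productSum _ z P q hq]
    -- There is a single product term, and the other player's factor has norm 1, so it drops out.
    have h := sum_norm_sq_updateFactor F P U P.other () (z P.other)
    rw [hF] at h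
    have h' : ∑ t, updateFactor F P (U : Matrix _ _ ℂ) P.other () (z P.other) t *
        star (updateFactor F P (U : Matrix _ _ ℂ) P.other () (z P.other) t) = 1 := by
      simp only [Complex.star_def, Complex.mul_conj']
      exact_mod_cast h
    simp only [Finset.univ_unique, Finset.sum_singleton]
    exact (congrArg _ h').trans (mul_one _)

/-! ### Acceptance probabilities. -/

namespace QuantumProtocol

variable {n c : ℕ}

/-- The pair of inputs `(x, y)` as a function on the players. -/
def inputs {X : Type} (x y : X) : Player → X
  | .alice => x
  | .bob => y

/-- The factors of the initial state. -/
def initFactor (P : QuantumProtocol n c) :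
    ∀ Q, Unit → (Fin n → Bool) → (Held P.own Q → Bool) → ℂ :=
  fun Q _ x => Pi.single (restrictBits P.own Q (P.initBits x x)) 1

theorem sum_norm_sq_initFactor (P : QuantumProtocol n c) (Q : Player) (i : Unit)
    (x : Fin n → Bool) : ∑ t, ‖P.initFactor Q i x t‖ ^ 2 = 1 := by
  rw [Finset.sum_eq_single (restrictBits P.own Q (P.initBits x x))]
  · simp [initFactor]
  · intro t _ ht
    simp [initFactor, Pi.single_eq_of_ne ht]
  · simp

/-- No player holds the other's input qubits at the start, so supplying his own input in both places
is harmless; this makes `initFactor` a function of one input. -/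
theorem restrictBits_initBits (P : QuantumProtocol n c) (Q : Player) (x y : Fin n → Bool) :
    restrictBits P.own Q (P.initBits (inputs x y Q) (inputs x y Q)) =
      restrictBits P.own Q (P.initBits x y) := by
  ext ⟨q, hq⟩
  have ha : Q = .bob → ∀ i, P.aliceIn i ≠ q := by
    rintro rfl i rfl
    simp [P.alice_owns] at hq
  have hb : Q = .alice → ∀ i, P.bobIn i ≠ q := by
    rintro rfl i rfl
    simp [P.bob_owns] at hq
  cases Q <;> simp_all [restrictBits, initBits, inputs]

theorem initState_eq_productSum (P : QuantumProtocol n c) (x y : Fin n → Bool) :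
    P.initState x y = productSum P.initFactor (inputs x y) := by
  ext s
  simp only [productSum, initFactor, restrictBits_initBits, Player.prod_eq _ Player.alice,
    Finset.univ_unique, Finset.sum_singleton, initState, Pi.single_apply]
  rw [ite_zero_mul_ite_zero]
  have h := (splitBits P.own .alice).apply_eq_iff_eq (x := s) (y := P.initBits x y)
  rw [Prod.ext_iff] at h
  simp only [← h, mul_one]
  rfl

theorem outputProb_true_add_false (P : QuantumProtocol n c) (x y : Fin n → Bool) :
    P.outputProb x y true + P.outputProb x y false = 1 := by
  rw [outputProb, outputProb, Rounds.outputProb_true_add_false,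
    Finset.sum_eq_single (P.initBits x y)]
  · simp [initState]
  · intro t _ ht
    simp [initState, Pi.single_eq_of_ne ht]
  · simp

/-- The real part of `u * v` is `u.re * v.re - u.im * v.im`, which doubles the rank. -/
theorem exists_outputProb_eq_sum (P : QuantumProtocol n c) :
    ∃ (κ : Type) (_ : Fintype κ) (u v : κ → (Fin n → Bool) → ℝ),
      Fintype.card κ = 2 * 4 ^ c ∧ (∀ k x, |u k x| ≤ 1) ∧ (∀ k y, |v k y| ≤ 1) ∧
      ∀ x y, P.outputProb x y true = ∑ k, u k x * v k y := by
  obtain ⟨κ, _, u, hκ, hu, h⟩ := P.rounds.exists_outputProb_eq_sum true P.initFactor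
    fun Q i x => (P.sum_norm_sq_initFactor Q i x).le
  refine ⟨κ ⊕ κ, inferInstance,
    Sum.elim (fun k x => (u .alice k x).re) (fun k x => -(u .alice k x).im),
    Sum.elim (fun k y => (u .bob k y).re) (fun k y => (u .bob k y).im), ?_, ?_, ?_, ?_⟩
  · simp [hκ]
    ring
  · rintro (k | k) x
    · exact (Complex.abs_re_le_norm _).trans (hu _ _ _)
    · simpa using (Complex.abs_im_le_norm _).trans (hu _ _ _)
  · rintro (k | k) x
    · exact (Complex.abs_re_le_norm _).trans (hu _ _ _)
    · exact (Complex.abs_im_le_norm _).trans (hu _ _ _)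
  · intro x y
    have := congrArg Complex.re (h (inputs x y))
    rw [outputProb, initState_eq_productSum, ← Complex.ofReal_re (P.rounds.outputProb _ _), this]
    simp [Finset.sum_sub_distrib, inputs, ← sub_eq_add_neg]

theorem exists_outputProb_eq_of_zero (P : QuantumProtocol n 0) :
    ∃ (Q : Player) (u : (Fin n → Bool) → ℝ),
      ∀ x y, P.outputProb x y true = u (inputs x y Q) := by
  obtain ⟨Q, u, h⟩ := P.rounds.exists_outputProb_eq_of_zero true P.initFactor
    fun Q i x => (P.sum_norm_sq_initFactor Q i x)
  refine ⟨Q, fun x => (u x).re, fun x y => ?_⟩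
  dsimp only
  rw [outputProb, initState_eq_productSum, ← h (inputs x y), Complex.ofReal_re]

theorem ComputesWithError.outputProb_mem {P : QuantumProtocol n c}
    {f : (Fin n → Bool) × (Fin n → Bool) → Bool} (h : P.ComputesWithError f (1 / 3))
    (x y : Fin n → Bool) :
    (f (x, y) = true → P.outputProb x y true ∈ Set.Icc (2 / 3) 1) ∧
      (f (x, y) = false → P.outputProb x y true ∈ Set.Icc 0 (1 / 3)) := by
  have h1 := P.outputProb_true_add_false x y
  have h2 : 0 ≤ P.outputProb x y true := P.rounds.outputProb_nonneg _ _
  have h3 : 0 ≤ P.outputProb x y false := P.rounds.outputProb_nonneg _ _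
  have h4 := h x y
  constructor <;> intro hf <;> rw [hf] at h4 <;> constructor <;> linarith

end QuantumProtocol

/-! ### Choice of constants and conclusion. -/

/-- Rounding the acceptance probabilities of a protocol, moved away from `0` and `1`. -/
theorem QuantumProtocol.exists_isSignedRectangleSum {n c : ℕ} (P : QuantumProtocol n c) :
    ∃ (M : (Fin n → Bool) × (Fin n → Bool) → ℤ) (N B : ℕ), 0 < B ∧
      2 * N + B ≤ 2 ^ (20 + 6 * c) ∧ IsSignedRectangleSum M N ∧
      ∀ x y, |(M (x, y) : ℝ) / B - (8 * P.outputProb x y true + 1) / 10| ≤ 1 / 25 := by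
  obtain ⟨κ, _, u, v, hκ, hu, hv, h⟩ := P.exists_outputProb_eq_sum
  set k := 2 * 4 ^ c with hk
  have hk0 : 0 < k := by positivity
  have hkr : (0 : ℝ) < k := by exact_mod_cast hk0
  -- With `L = 40 * k` the rounding error `2 * k / L` of the probability is `1 / 20`.
  obtain ⟨M, hM, hMP⟩ := exists_isSignedRectangleSum_near u v hu hv (40 * k)
  rw [hκ] at hM
  -- This realizes `(8 * p + 1) / 10`, which lies in `[1/10, 9/10]`; the error becomes `1 / 25`, so
  -- the quotient stays in `[0, 1]`, as a coin bias must.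
  refine ⟨fun p => (8 : ℕ) * M p + ((40 * k) ^ 2 : ℕ), 8 * (4 * k * (40 * k) ^ 2) + (40 * k) ^ 2,
    10 * (40 * k) ^ 2, by positivity, ?_,
    ((IsSignedRectangleSum.natCast 8).mul hM).add (IsSignedRectangleSum.natCast _), ?_⟩
  · have e : k ^ 3 = 8 * 2 ^ (6 * c) := by
      rw [hk, show (4 : ℕ) = 2 ^ 2 by rfl, ← pow_mul, mul_pow, ← pow_mul]
      congr 2
      ring
    have : k ^ 2 ≤ k ^ 3 := Nat.pow_le_pow_right hk0 (by norm_num)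
    calc 2 * (8 * (4 * k * (40 * k) ^ 2) + (40 * k) ^ 2) + 10 * (40 * k) ^ 2
        = 102400 * k ^ 3 + 19200 * k ^ 2 := by ring
      _ ≤ 121600 * k ^ 3 := by omega
      _ ≤ 2 ^ 20 * 2 ^ (6 * c) := by rw [e]; omega
      _ = 2 ^ (20 + 6 * c) := (pow_add ..).symm
  · intro x y
    have h1 := hMP (x, y)
    rw [← h, hκ] at h1
    push_cast at h1 ⊢
    have e : (8 * (M (x, y) : ℝ) + (40 * k) ^ 2) / (10 * (40 * k) ^ 2) -
        (8 * P.outputProb x y true + 1) / 10 =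
        8 * ((M (x, y) : ℝ) - (40 * k) ^ 2 * P.outputProb x y true) / (10 * (40 * k) ^ 2) := by
      field_simp
      ring
    rw [e, abs_div, abs_mul, abs_of_pos (show (0 : ℝ) < 10 * (40 * k) ^ 2 by positivity),
      abs_of_pos (show (0 : ℝ) < 8 by norm_num), div_le_iff₀ (by positivity)]
    nlinarith

/-- The 23rd power of `97 / 100` is below `1 / 2`; the `+ 1` in the ceiling absorbs the factor 2. -/
theorem two_mul_pow_le (d : ℝ) :
    2 * (97 / 100 : ℝ) ^ (23 * ⌈d + 1⌉₊) ≤ 1 / (2 : ℝ) ^ d := by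
  have h1 : (97 / 100 : ℝ) ^ (23 * ⌈d + 1⌉₊) ≤ (1 / 2) ^ ⌈d + 1⌉₊ := by
    rw [pow_mul]
    exact pow_le_pow_left₀ (by norm_num) (by norm_num) _
  have h2 : (2 : ℝ) ^ (d + 1) ≤ 2 ^ ⌈d + 1⌉₊ := by
    rw [← Real.rpow_natCast]
    exact Real.rpow_le_rpow_of_exponent_le (by norm_num) (Nat.le_ceil _)
  rw [Real.rpow_add (by norm_num), Real.rpow_one] at h2
  have h3 : (0 : ℝ) < 2 ^ d := by positivity
  calc 2 * (97 / 100 : ℝ) ^ (23 * ⌈d + 1⌉₊) ≤ 2 * (1 / 2) ^ ⌈d + 1⌉₊ := by gcongr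
    _ = 2 * (1 / 2 ^ ⌈d + 1⌉₊) := by rw [one_div_pow]
    _ ≤ 2 * (1 / (2 ^ d * 2)) := by gcongr
    _ = 1 / 2 ^ d := by field_simp

/-- Probability `1 / 3` becomes `11 / 30`, and adding `1 / 25` stays below `41 / 100`. There `4 * t
* (1 - t) ≤ 97 / 100`. -/
theorem majority_mem_of_le (d : ℝ) {t : ℝ} (h0 : 0 ≤ t) (ht : t ≤ 41 / 100) :
    majority (23 * ⌈d + 1⌉₊) t ∈ Set.Icc 0 (1 / (2 : ℝ) ^ d) := by
  refine ⟨majority_nonneg _ h0 (by linarith),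
    (majority_le_of_le_half _ h0 (by linarith)).trans (le_trans ?_ (two_mul_pow_le d))⟩
  have : 4 * (t * (1 - t)) ≤ 97 / 100 := by nlinarith
  have : 0 ≤ t * (1 - t) := mul_nonneg h0 (by linarith)
  gcongr

theorem majority_mem_of_ge (d : ℝ) {t : ℝ} (ht : 59 / 100 ≤ t) (h1 : t ≤ 1) :
    majority (23 * ⌈d + 1⌉₊) t ∈ Set.Icc (1 - 1 / (2 : ℝ) ^ d) 1 := by
  have h := majority_mem_of_le d (t := 1 - t) (by linarith) (by linarith)
  have e := majority_add_majority (23 * ⌈d + 1⌉₊) t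
  constructor <;> linarith [h.1, h.2]

/-- The signs and the common absolute value of the weights are read off from a signed sum. -/
theorem IsSignedRectangleSum.exists_fin {X Y : Type} {g : X × Y → ℤ} {N : ℕ}
    (h : IsSignedRectangleSum g N) (α : ℝ) :
    ∃ (N' : ℕ) (R : Fin N' → Set (X × Y)) (w : Fin N' → ℝ), N' ≤ N ∧
      (∀ i, IsRectangle (R i)) ∧ (∀ i, w i = α ∨ w i = -α) ∧
      ∀ p, ∑ i, w i * (R i).indicator (fun _ => (1 : ℝ)) p = α * g p := by
  obtain ⟨ι, _, R, ε, hc, hR, hε, hg⟩ := h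
  let e := (Fintype.equivFin ι).symm
  refine ⟨Fintype.card ι, fun i => R (e i), fun i => α * ε (e i), hc, fun i => hR _,
    fun i => ?_, fun p => ?_⟩
  · rcases hε (e i) with h | h <;> simp [h]
  · rw [Equiv.sum_comp e fun i => α * ε i * (R i).indicator (fun _ => (1 : ℝ)) p, hg]
    push_cast
    rw [Finset.mul_sum]
    refine Finset.sum_congr rfl fun i _ => ?_
    by_cases hp : p ∈ R i <;> simp [hp]

/-- The output distribution depends on one player's input only, and error below `1 / 2` makes `f`
depend on it alone. -/
theorem QuantumProtocol.ComputesWithError.isRectangle {n : ℕ} {P : QuantumProtocol n 0}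
    {f : (Fin n → Bool) × (Fin n → Bool) → Bool} (h : P.ComputesWithError f (1 / 3)) :
    IsRectangle {p | f p = true} := by
  obtain ⟨Q, u, hu⟩ := P.exists_outputProb_eq_of_zero
  have key : ∀ x y, f (x, y) = true ↔ 1 / 2 ≤ u (inputs x y Q) := by
    intro x y
    have h1 := h.outputProb_mem x y
    rw [hu] at h1
    cases hf : f (x, y)
    · have := (h1.2 hf).2
      simp; linarith
    · have := (h1.1 hf).1
      simp; linarith
  cases Q
  · exact ⟨{x | 1 / 2 ≤ u x}, Set.univ, by ext ⟨x, y⟩; simpa [inputs] using key x y⟩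
  · exact ⟨Set.univ, {y | 1 / 2 ≤ u y}, by ext ⟨x, y⟩; simpa [inputs] using key x y⟩

/-- From `c ≥ 1` and `d ≥ 1` the two factors of the exponent are at most `26 * c` and `139 * d`, and
`26 * 139 < 4000`. -/
theorem natCast_pow_le_two_rpow {N c : ℕ} (hN : N ≤ 2 ^ (20 + 6 * c)) (hc : 1 ≤ c) (d : ℝ)
    (hd : 1 ≤ d) :
    ((N ^ (2 * (23 * ⌈d + 1⌉₊) + 1) : ℕ) : ℝ) ≤ (2 : ℝ) ^ ((4000 : ℕ) * d * c) := by
  have h1 : (N : ℝ) ≤ 2 ^ (20 + 6 * c) := by exact_mod_cast hN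
  have h2 : (⌈d + 1⌉₊ : ℝ) < d + 1 + 1 := Nat.ceil_lt_add_one (by linarith)
  have hc' : (1 : ℝ) ≤ c := by exact_mod_cast hc
  push_cast
  calc (N : ℝ) ^ (2 * (23 * ⌈d + 1⌉₊) + 1)
      ≤ (2 ^ (20 + 6 * c)) ^ (2 * (23 * ⌈d + 1⌉₊) + 1) := by gcongr
    _ = (2 : ℝ) ^ ((((20 + 6 * c) * (2 * (23 * ⌈d + 1⌉₊) + 1) : ℕ)) : ℝ) := by
        rw [← pow_mul, Real.rpow_natCast]
    _ ≤ (2 : ℝ) ^ (4000 * d * c) := by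
        refine Real.rpow_le_rpow_of_exponent_le (by norm_num) ?_
        push_cast
        calc (20 + 6 * (c : ℝ)) * (2 * (23 * ⌈d + 1⌉₊) + 1) ≤ (26 * c) * (139 * d) := by
              gcongr <;> linarith
          _ ≤ 4000 * d * c := by
            nlinarith [mul_nonneg (by linarith : 0 ≤ d) (by linarith : 0 ≤ (c : ℝ))]

theorem lemma3p3 :
    ∃ K : ℕ, ∀ (n c : ℕ) (f : (Fin n → Bool) × (Fin n → Bool) → Bool) (d : ℝ), 1 ≤ d →
      (∃ P : QuantumProtocol n c, P.ComputesWithError f (1 / 3)) →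
      ∃ α : ℝ, α ∈ Set.Icc (0 : ℝ) 1 ∧
        ∃ (N : ℕ) (R : Fin N → Set ((Fin n → Bool) × (Fin n → Bool))) (w : Fin N → ℝ),
          (N : ℝ) ≤ (2 : ℝ) ^ ((K : ℝ) * d * (c : ℝ)) ∧
          (∀ i, IsRectangle (R i)) ∧
          (∀ i, w i = α ∨ w i = -α) ∧
          ∀ x y : Fin n → Bool,
            (f (x, y) = true →
              ∑ i, w i * (R i).indicator (fun _ => (1 : ℝ)) (x, y) ∈
                Set.Icc (1 - 1 / (2 : ℝ) ^ d) 1) ∧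
            (f (x, y) = false →
              ∑ i, w i * (R i).indicator (fun _ => (1 : ℝ)) (x, y) ∈
                Set.Icc 0 (1 / (2 : ℝ) ^ d)) := by
  refine ⟨4000, fun n c f d hd ⟨P, hP⟩ => ?_⟩
  have h2 : 0 < 1 / (2 : ℝ) ^ d := by positivity
  -- For `c = 0` the bound on `N` is 1, and the set where `f` is true serves as the only rectangle.
  rcases Nat.eq_zero_or_pos c with rfl | hc
  · refine ⟨1, by simp, 1, fun _ => {p | f p = true}, fun _ => 1, by simp, fun _ => hP.isRectangle,
      by simp, fun x y => ⟨fun h => ?_, fun h => ?_⟩⟩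
    · simpa [h] using h2.le
    · simpa [h] using h2.le
  · obtain ⟨M, N₀, B, hB, hN₀, hM, hMP⟩ := P.exists_isSignedRectangleSum
    obtain ⟨G, hG, hGM⟩ := hM.exists_majority hB (23 * ⌈d + 1⌉₊)
    obtain ⟨N, R, w, hN, hR, hw, hsum⟩ :=
      hG.exists_fin (1 / (B : ℝ) ^ (2 * (23 * ⌈d + 1⌉₊) + 1))
    have hB1 : (1 : ℝ) ≤ B := by exact_mod_cast hB
    refine ⟨_, ⟨by positivity, (div_le_one (by positivity)).2 (one_le_pow₀ hB1)⟩, N, R, w,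
      (Nat.cast_le.2 hN).trans (natCast_pow_le_two_rpow hN₀ hc d hd), hR, hw, fun x y => ?_⟩
    rw [hsum, hGM]
    have h := abs_le.1 (hMP x y)
    have hp := hP.outputProb_mem x y
    constructor <;> intro hf
    · have := hp.1 hf
      exact majority_mem_of_ge d (by linarith [this.1]) (by linarith [this.2])
    · have := hp.2 hf
      exact majority_mem_of_le d (by linarith [this.1]) (by linarith [this.2])
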